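/- Let $K$ be a field of characteristic $0$, let $\mathbf G$ be a connected affine algebraic group over $K$ with coordinate Hopf algebra $K[\mathbf G]$ (a commutative, finitely generated Hopf algebra over $K$), and let $\mathbf Z$ be its center, i.e. the closed subgroup whose group of $\bar K$-points is the center of the group $\mathbf G(\bar K)$, where $\bar K$ is an algebraic closure of $K$. Let $\mathbf G/\mathbf Z$ be the quotient algebraic group; its coordinate ring $K[\mathbf G/\mathbf Z]$ is the algebra of functions in $K[\mathbf G]$ that are invariant under translation by $\mathbf Z$. For a commutative $K$-algebra $A$ write $\mathbf G(A)=\mathrm{Hom}_{K\text{-alg}}(K[\mathbf G],A)$ and $(\mathbf G/\mathbf Z)(A)=\mathrm{Hom}_{K\text{-alg}}(K[\mathbf G/\mathbf Z],A)$. Let $H<\mathbf G(K)$ be a subgroup that is Zariski dense in $\mathbf G$, i.e. no non-zero function in $K[\mathbf G]$ vanishes on $H$. Let $A$ be a commutative $K$-algebra and let $$C=\{g\in\mathbf G(A)\;:\; H_A\cap gH_Ag^{-1}\text{ has finite index in both } H_A \text{ and } gH_Ag^{-1}\}$$ be the commensurator in $\mathbf G(A)$ of the image $H_A$ of $H$ under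 the map $\mathbf G(K)\to\mathbf G(A)$ induced by $K\to A$. Then the image of $C$ in $(\mathbf G/\mathbf Z)(A)$ is contained in the image of $(\mathbf G/\mathbf Z)(K)$ in $(\mathbf G/\mathbf Z)(A)$. -/

import Mathlib

/-! Affine algebraic groups over a field `K` are given by their coordinate rings: commutative Hopf
algebras `R = K[G]`, finitely generated as `K`-algebras. -/

namespace AffineGroup

noncomputable section

section Points

variable (K R A : Type*) [Field K] [CommRing R] [HopfAlgebra K R] [CommRing A] [Algebra K A]

/-- The set `G(A) = Hom_{K-alg}(K[G], A)` of `A`-points of the affine group `G` with coordinate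
Hopf algebra `R = K[G]`. -/
def Points : Type _ := WithConv (R →ₐ[K] A)

variable {K R A}

/-- The value `f(x)` of the regular function `f` at the `A`-point `x`. -/
def Points.eval (x : Points K R A) (f : R) : A := WithConv.ofConv x f

/-- The product of `x` and `y` is `m ∘ (x ⊗ y) ∘ Δ` and the identity is the counit: these are
Mathlib's convolution operations. -/
instance : Monoid (Points K R A) := inferInstanceAs (Monoid (WithConv (R →ₐ[K] A)))

/-- The inverse of `x` is `x ∘ S`, where `S` is the antipode. -/
instance : Inv (Points K R A) where
  inv x := WithConv.toConv ((WithConv.ofConv x).comp (HopfAlgebra.antipodeAlgHom K R))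

instance : Group (Points K R A) where
  inv_mul_cancel x := by
    have h := AlgHom.comp_convMul_distrib (WithConv.ofConv x)
      (WithConv.toConv (HopfAlgebra.antipodeAlgHom K R)) (WithConv.toConv (AlgHom.id K R))
    rw [AlgHom.antipode_id_cancel] at h
    refine (WithConv.ofConv_injective h).symm.trans (WithConv.ofConv_injective ?_)
    exact AlgHom.ext fun r => (WithConv.ofConv x).commutes _

/-- The homomorphism `G(A) → G(B)` induced by a `K`-algebra homomorphism `A → B`. -/
def Points.map {B : Type*} [CommRing B] [Algebra K B] (φ : A →ₐ[K] B) :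
    Points K R A →* Points K R B where
  toFun x := WithConv.toConv (φ.comp (WithConv.ofConv x))
  map_one' := by
    apply WithConv.ofConv_injective
    apply AlgHom.ext
    intro r
    exact φ.commutes _
  map_mul' x y := WithConv.ofConv_injective (AlgHom.comp_convMul_distrib φ _ _)

/-- A subgroup `H` of `G(K)` is Zariski dense in `G` if the only regular function in `K[G]` that
vanishes on `H` is zero. -/
def IsZariskiDense (H : Subgroup (Points K R K)) : Prop :=
  ∀ f : R, (∀ h ∈ H, h.eval f = 0) → f = 0

end Points

section Quotient

variable (K R : Type*) [Field K] [CommRing R] [HopfAlgebra K R]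

/-- The coordinate ring `K[G/Z] = K[G]^Z` of the quotient of `G` by its center `Z`: the regular
functions `f ∈ K[G]` that are constant on the cosets of `Z`, that is, `f(xz) = f(x)` for all
geometric points `x` of `G` and `z` of `Z`. Here the geometric points of `Z` are the elements of
the center of the abstract group of geometric points of `G`. -/
def centerQuotientRing : Subalgebra K R where
  carrier := {f | ∀ x z : Points K R (AlgebraicClosure K), z ∈ Subgroup.center _ →
    (x * z).eval f = x.eval f}
  mul_mem' {f f'} hf hf' x z hz := by
    have h := hf x z hz
    have h' := hf' x z hz
    simp only [Points.eval, map_mul] at h h' ⊢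
    rw [h, h']
  add_mem' {f f'} hf hf' x z hz := by
    have h := hf x z hz
    have h' := hf' x z hz
    simp only [Points.eval, map_add] at h h' ⊢
    rw [h, h']
  algebraMap_mem' c x z _ := by
    simp only [Points.eval, AlgHom.commutes]

/-- The set `(G/Z)(A) = Hom_{K-alg}(K[G/Z], A)` of `A`-points of the quotient `G/Z`. -/
abbrev CenterQuotientPoints (A : Type*) [CommRing A] [Algebra K A] : Type _ :=
  centerQuotientRing K R →ₐ[K] A

variable {K R} {A : Type*} [CommRing A] [Algebra K A]

/-- The map `G(A) → (G/Z)(A)` induced by the quotient morphism `G → G/Z`, whose comorphism is the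
inclusion of `K[G/Z]` in `K[G]`. -/
def Points.toCenterQuotient (x : Points K R A) : CenterQuotientPoints K R A :=
  (WithConv.ofConv x).comp (centerQuotientRing K R).val

/-- The map `(G/Z)(A) → (G/Z)(B)` induced by a `K`-algebra homomorphism `A → B`. -/
def CenterQuotientPoints.map {B : Type*} [CommRing B] [Algebra K B] (φ : A →ₐ[K] B)
    (q : CenterQuotientPoints K R A) : CenterQuotientPoints K R B :=
  φ.comp q

end Quotient

end

end AffineGroup

/-! For `g` in the commensurator, the rational points `h` with `g h g⁻¹ ∈ H_A` form a group `H'`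
meeting `H` in finite index, so `H'` is dense because `G` is connected
(`IsZariskiDense.of_finiteIndex`). For such `h` the conjugate is rational, so the two images `g₁,
g₂` of `g` in `G(A ⊗ A)` conjugate `h` alike, and `z = g₁⁻¹ g₂` centralizes `H'`. If `f ∈ K[G/Z]` is
invariant under `z`, then `f(g₁) = f(g₂)`, that is `f(g) ⊗ 1 = 1 ⊗ f(g)`, which forces `f(g) ∈ K`.

Since `Z` is given by geometric points but `z` has values in an arbitrary ring, the invariance
(`eval_mul_of_mem_centerQuotientRing`) needs the scheme-theoretic centralizer of `H'` to be reduced.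
This is Cartier's theorem (`HopfAlgebra.isReduced`), and the place where characteristic zero enters.
-/

/-! ### Invariant derivations and nilpotents at the identity -/

/-- Differentiating `f ^ (k + 1) * D f ^ m = 0` and multiplying by `D f` trades one factor `f` for
two factors `D f`, up to the invertible scalar `k + 1`. -/
theorem Derivation.isNilpotent_apply {K Q : Type*} [Field K] [CharZero K] [CommRing Q] [Algebra K Q]
    (D : Derivation K Q Q) {f : Q} (hf : IsNilpotent f) : IsNilpotent (D f) := by
  suffices h : ∀ k m : ℕ, f ^ k * D f ^ m = 0 → IsNilpotent (D f) by
    obtain ⟨n, hn⟩ := hf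
    exact h n 0 (by simp [hn])
  intro k
  induction k with
  | zero => exact fun m hm => ⟨m, by simpa using hm⟩
  | succ k ih =>
    intro m hm
    refine ih (m + 2) ?_
    have h := congrArg D hm
    rw [Derivation.leibniz, Derivation.leibniz_pow, Derivation.leibniz_pow, map_zero] at h
    simp only [smul_eq_mul, nsmul_eq_mul, Nat.add_sub_cancel] at h
    have h2 : ((k + 1 : ℕ) : Q) * (f ^ k * D f ^ (m + 2)) = 0 := by
      rcases m with _ | m
      · have h' := congrArg (· * D f) h
        simp only [zero_mul] at h'
        rw [← h']
        simp
        ring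
      · simp only [Nat.add_sub_cancel] at h
        have h' := congrArg (· * D f) h
        simp only [zero_mul] at h'
        have h'' := congrArg (· * (((m + 1 : ℕ) : Q) * D (D f))) hm
        simp only [zero_mul] at h''
        linear_combination h' - h''
    have hu : ((k + 1 : ℕ) : Q) = algebraMap K Q ((k + 1 : ℕ) : K) := by simp
    rw [hu, ← Algebra.smul_def] at h2
    exact (smul_eq_zero_iff_right (by exact_mod_cast k.succ_ne_zero)).mp h2

namespace Bialgebra

open _root_.TensorProduct Coalgebra

variable {K Q : Type*} [Field K] [CommRing Q] [Bialgebra K Q]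

/-- The derivation `f ↦ ∑ f₍₁₎ P(f₍₂₎)` attached to a linear map `P` that is a derivation at the
counit. -/
noncomputable def invariantDerivation (P : Q →ₗ[K] Q)
    (hP : ∀ a b, P (a * b) = counit (R := K) a • P b + counit (R := K) b • P a) :
    Derivation K Q Q :=
  Derivation.mk' (LinearMap.mul' K Q ∘ₗ P.lTensor Q ∘ₗ comul) <| by
    have key : ∀ w w' : Q ⊗[K] Q, LinearMap.mul' K Q (P.lTensor Q (w * w')) =
        _root_.TensorProduct.rid K Q ((counit (R := K)).lTensor Q w) *
          LinearMap.mul' K Q (P.lTensor Q w') +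
        _root_.TensorProduct.rid K Q ((counit (R := K)).lTensor Q w') *
          LinearMap.mul' K Q (P.lTensor Q w) := by
      intro w w'
      induction w with
      | zero => simp
      | add x y hx hy => simp only [add_mul, map_add, hx, hy]; ring
      | tmul a b =>
        induction w' with
        | zero => simp
        | add x y hx hy => simp only [mul_add, map_add, hx, hy]; ring
        | tmul a' b' =>
          simp only [Algebra.TensorProduct.tmul_mul_tmul, LinearMap.lTensor_tmul,
            LinearMap.mul'_apply, hP, _root_.TensorProduct.rid_tmul, Algebra.smul_def]
          ring
    intro a b
    have h := key (comul a) (comul b)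
    rw [← Bialgebra.comul_mul, Coalgebra.lTensor_counit_comul,
      Coalgebra.lTensor_counit_comul] at h
    simpa using h

theorem invariantDerivation_apply (P : Q →ₗ[K] Q)
    (hP : ∀ a b, P (a * b) = counit (R := K) a • P b + counit (R := K) b • P a) (f : Q) :
    invariantDerivation P hP f = LinearMap.mul' K Q (P.lTensor Q (comul f)) := rfl

variable (K Q) in
/-- The augmentation ideal of a bialgebra. -/
noncomputable def augmentationIdeal : Ideal Q := RingHom.ker (counitAlgHom K Q)

theorem mem_augmentationIdeal {f : Q} : f ∈ augmentationIdeal K Q ↔ counit (R := K) f = 0 := Iff.rfl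

theorem sub_counit_mem (f : Q) : f - algebraMap K Q (counit f) ∈ augmentationIdeal K Q := by
  simp [mem_augmentationIdeal]

instance : (augmentationIdeal K Q).IsPrime := RingHom.ker_isPrime _

/-- An invariant derivation with values in the ideal `m` maps nilpotents into `m * N`. -/
theorem invariantDerivation_mem_mul_nilradical [CharZero K] (P : Q →ₗ[K] Q)
    (hP : ∀ a b, P (a * b) = counit (R := K) a • P b + counit (R := K) b • P a)
    {m : Ideal Q} (hm : ∀ f, P f ∈ m) {f : Q} (hf : f ∈ nilradical Q) :
    invariantDerivation P hP f ∈ m * nilradical Q := by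
  classical
  -- In a basis of the range of `P`, the derivative of `f` is a sum of basis vectors, which lie in
  -- `m`, times coefficients that are themselves invariant derivatives of `f`, hence nilpotent.
  let b := Module.Basis.ofVectorSpace K (LinearMap.range P)
  let w := P.rangeRestrict.lTensor Q (comul f)
  have hw : w = (equivFinsuppOfBasisRight b).symm (equivFinsuppOfBasisRight b w) := by simp
  have hD : invariantDerivation P hP f =
      LinearMap.mul' K Q ((LinearMap.range P).subtype.lTensor Q w) := by
    rw [invariantDerivation_apply, ← LinearMap.comp_apply ((LinearMap.range P).subtype.lTensor Q),
      ← LinearMap.lTensor_comp]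
    rfl
  rw [hD, hw, equivFinsuppOfBasisRight_symm_apply, Finsupp.sum, map_sum, map_sum]
  refine Ideal.sum_mem _ fun i _ => ?_
  rw [LinearMap.lTensor_tmul, LinearMap.mul'_apply, mul_comm m]
  refine Ideal.mul_mem_mul ?_ ?_
  · let Pi : Q →ₗ[K] Q := Algebra.linearMap K Q ∘ₗ b.coord i ∘ₗ P.rangeRestrict
    have hPi : ∀ a c, Pi (a * c) = counit (R := K) a • Pi c + counit (R := K) c • Pi a := by
      intro a c
      have : P.rangeRestrict (a * c) =
          counit (R := K) a • P.rangeRestrict c + counit (R := K) c • P.rangeRestrict a :=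
        Subtype.ext (by simpa using hP a c)
      simp only [Pi, LinearMap.comp_apply, this, map_add, map_smul]
    have : equivFinsuppOfBasisRight b w i = invariantDerivation Pi hPi f := by
      rw [equivFinsuppOfBasisRight_apply, invariantDerivation_apply,
        ← LinearMap.comp_apply ((b.coord i).lTensor Q), ← LinearMap.lTensor_comp]
      simp only [Pi, LinearMap.lTensor_comp, LinearMap.comp_apply]
      generalize (b.coord i).lTensor Q (P.rangeRestrict.lTensor Q (comul f)) = v
      induction v with
      | zero => simp
      | add x y hx hy => simp only [map_add, hx, hy]
      | tmul x y => simp [Algebra.smul_def, mul_comm]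
    rw [this]
    exact Derivation.isNilpotent_apply _ hf
  · obtain ⟨c, hc⟩ := (b i).2
    simpa [← hc] using hm c

/-- There is a derivation at the counit which is the identity modulo `m ^ 2` on `m`. -/
theorem exists_counit_derivation : ∃ P : Q →ₗ[K] Q,
    (∀ a b, P (a * b) = counit (R := K) a • P b + counit (R := K) b • P a) ∧
    (∀ f, P f ∈ augmentationIdeal K Q) ∧
    ∀ f ∈ augmentationIdeal K Q, P f - f ∈ augmentationIdeal K Q ^ 2 := by
  let V := (augmentationIdeal K Q ^ 2).restrictScalars K
  -- `P` sends `f` to a linear lift of the class of `f - ε(f)` modulo `m ^ 2`. The product rule is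
  -- exact because `(a - ε(a)) (b - ε(b))` dies in the quotient before lifting.
  obtain ⟨s, hs⟩ := V.mkQ.exists_rightInverse_of_surjective V.range_mkQ
  let p : Q →ₗ[K] Q := LinearMap.id - Algebra.linearMap K Q ∘ₗ counit
  have hp : ∀ f, p f = f - algebraMap K Q (counit f) := fun f => rfl
  have hsub : ∀ f, s (V.mkQ (p f)) - p f ∈ augmentationIdeal K Q ^ 2 := by
    intro f
    have h := LinearMap.congr_fun hs (V.mkQ (p f))
    exact (Submodule.Quotient.eq V).mp h
  refine ⟨s ∘ₗ V.mkQ ∘ₗ p, ?_, ?_, ?_⟩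
  · intro a b
    have : V.mkQ (p (a * b)) =
        counit (R := K) a • V.mkQ (p b) + counit (R := K) b • V.mkQ (p a) := by
      rw [← map_smul V.mkQ, ← map_smul V.mkQ, ← map_add]
      refine (Submodule.Quotient.eq V).mpr ?_
      have h := Ideal.mul_mem_mul (sub_counit_mem (K := K) a) (sub_counit_mem (K := K) b)
      rw [← sq] at h
      change _ ∈ augmentationIdeal K Q ^ 2
      convert h using 1
      simp only [hp, Bialgebra.counit_mul, Algebra.smul_def, map_mul]
      ring
    simp only [LinearMap.comp_apply, this, map_add, map_smul]
  · intro f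
    have h := Ideal.add_mem _ (Ideal.pow_le_self two_ne_zero (hsub f)) (sub_counit_mem (K := K) f)
    rw [hp, sub_add_cancel] at h
    exact h
  · intro f hf
    have h := hsub f
    rw [hp, mem_augmentationIdeal.mp hf, map_zero, sub_zero] at h
    simpa [hp, mem_augmentationIdeal.mp hf] using h

/-- The invariant derivation `E` acts on `m ^ k / m ^ (k + 1)` as multiplication by `k`, like an
Euler field. If nilpotents lie in `m ^ k`, then for nilpotent `f` one has `E f ∈ m * N ≤ m ^ (k +
1)`, so `k f ∈ m ^ (k + 1)`, and `k` can be inverted once it is positive. -/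
theorem nilradical_le_augmentationIdeal_pow [CharZero K] (k : ℕ) :
    nilradical Q ≤ augmentationIdeal K Q ^ k := by
  obtain ⟨P, hP, hPm, hPid⟩ := exists_counit_derivation (K := K) (Q := Q)
  set m := augmentationIdeal K Q
  let E := invariantDerivation P hP
  have hE1 : ∀ f ∈ m, E f - f ∈ m ^ 2 := by
    intro f hf
    have key : ∀ w : Q ⊗[K] Q, LinearMap.mul' K Q (P.lTensor Q w) -
        P (_root_.TensorProduct.lid K Q ((counit (R := K)).rTensor Q w)) ∈ m ^ 2 := by
      intro w
      induction w with
      | zero => simp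
      | add x y hx hy =>
        simp only [map_add]
        rw [add_sub_add_comm]
        exact Ideal.add_mem _ hx hy
      | tmul a b =>
        have h := Ideal.mul_mem_mul (sub_counit_mem (K := K) a) (hPm b)
        rw [← sq] at h
        rw [sub_mul, ← Algebra.smul_def, ← map_smul] at h
        exact h
    have h := key (comul f)
    rw [Coalgebra.rTensor_counit_comul] at h
    simpa [E, invariantDerivation_apply] using Ideal.add_mem _ h (hPid f hf)
  have hEk : ∀ k : ℕ, ∀ f ∈ m ^ k, E f - k * f ∈ m ^ (k + 1) := by
    intro k
    induction k with
    | zero =>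
      intro f _
      have : ∀ w : Q ⊗[K] Q, LinearMap.mul' K Q (P.lTensor Q w) ∈ m := by
        intro w
        induction w with
        | zero => simp
        | add x y hx hy => simpa using Ideal.add_mem _ hx hy
        | tmul a b => simpa using Ideal.mul_mem_left _ a (hPm b)
      simpa [E, invariantDerivation_apply] using this (comul f)
    | succ k ih =>
      intro f hf
      rw [pow_succ] at hf
      induction hf using Submodule.mul_induction_on' with
      | mem_mul_mem a ha b hb =>
        have h1 := Ideal.mul_mem_mul ha (hE1 b hb)
        have h2 := Ideal.mul_mem_mul (ih a ha) hb
        rw [← pow_add] at h1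
        rw [← pow_succ] at h2
        convert Ideal.add_mem _ h1 h2 using 1
        rw [Derivation.leibniz]
        simp only [smul_eq_mul]
        push_cast
        ring
      | add x _ y _ hx hy =>
        convert Ideal.add_mem _ hx hy using 1
        rw [map_add]
        ring
  induction k with
  | zero => simp
  | succ k ih =>
    rcases Nat.eq_zero_or_pos k with rfl | hk
    · simpa using nilradical_le_prime m
    · intro f hf
      have h1 : E f ∈ m ^ (k + 1) := by
        rw [pow_succ']
        exact Ideal.mul_mono_right ih (invariantDerivation_mem_mul_nilradical P hP hPm hf)
      have h2 := Ideal.sub_mem _ h1 (hEk k f (ih hf))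
      rw [sub_sub_cancel] at h2
      have h3 := Ideal.mul_mem_left _ (algebraMap K Q (k : K)⁻¹) h2
      rw [← mul_assoc, ← map_natCast (algebraMap K Q) k, ← map_mul,
        inv_mul_cancel₀ (by exact_mod_cast hk.ne'), map_one, one_mul] at h3
      exact h3

/-- Near the identity, a nilpotent function on an algebraic monoid vanishes. -/
theorem exists_mul_eq_zero_of_isNilpotent [CharZero K] [IsNoetherianRing Q] {f : Q}
    (hf : IsNilpotent f) : ∃ u : Q, counit (R := K) u = 1 ∧ u * f = 0 := by
  have h : f ∈ (⨅ i : ℕ, augmentationIdeal K Q ^ i • ⊤ : Submodule Q Q) := by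
    rw [Submodule.mem_iInf]
    intro i
    simpa using nilradical_le_augmentationIdeal_pow (K := K) i hf
  -- Krull's intersection theorem.
  obtain ⟨r, hr⟩ := (Ideal.mem_iInf_smul_pow_eq_bot_iff _ f).mp h
  refine ⟨1 - r, ?_, ?_⟩
  · simp [mem_augmentationIdeal.mp r.2]
  · rw [sub_mul, one_mul, ← smul_eq_mul (r : Q), hr, sub_self]

end Bialgebra

/-! ### Points, Zariski closure and density -/

namespace AffineGroup

open TensorProduct

noncomputable section

namespace Points

variable {K R : Type*} [Field K] [CommRing R] [HopfAlgebra K R]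
  {A B C : Type*} [CommRing A] [Algebra K A] [CommRing B] [Algebra K B] [CommRing C] [Algebra K C]

theorem ext {x y : Points K R A} (h : ∀ f, x.eval f = y.eval f) : x = y :=
  WithConv.ofConv_injective (AlgHom.ext h)

theorem eval_one (f : R) : (1 : Points K R A).eval f = algebraMap K A (Coalgebra.counit f) := rfl

theorem eval_inv (x : Points K R A) (f : R) : x⁻¹.eval f = x.eval (HopfAlgebra.antipode K f) := rfl

theorem eval_map (φ : A →ₐ[K] B) (x : Points K R A) (f : R) : (map φ x).eval f = φ (x.eval f) := rfl

theorem map_map (φ : A →ₐ[K] B) (ψ : B →ₐ[K] C) (x : Points K R A) :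
    map ψ (map φ x) = map (ψ.comp φ) x := rfl

/-- The universal point of an affine group, corresponding to the identity of the coordinate ring. -/
def univ : Points K R R := WithConv.toConv (AlgHom.id K R)

theorem eval_univ (f : R) : (univ : Points K R R).eval f = f := rfl

theorem map_univ (x : Points K R A) : map (WithConv.ofConv x) univ = x := rfl

variable (A) in
/-- The `A`-point defined by a rational point. -/
def const : Points K R K →* Points K R A := map (Algebra.ofId K A)

theorem eval_const (h : Points K R K) (f : R) : (const A h).eval f = algebraMap K A (h.eval f) := rfl

@[simp]
theorem map_const (φ : A →ₐ[K] B) (h : Points K R K) : map φ (const A h) = const B h :=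
  ext fun f => by simp [eval_map, eval_const]

theorem const_self (h : Points K R K) : const K h = h := rfl

/-- The algebra endomorphism `f ↦ f(h ·)` of the coordinate ring. -/
def leftTranslate (h : Points K R K) : R →ₐ[K] R := WithConv.ofConv (const R h * univ)

theorem leftTranslate_apply (h : Points K R K) (f : R) :
    leftTranslate h f = (const R h * univ).eval f := rfl

theorem eval_leftTranslate (x : Points K R A) (h : Points K R K) (f : R) :
    x.eval (leftTranslate h f) = (const A h * x).eval f := by
  have := eval_map (WithConv.ofConv x) (const R h * univ) f
  rw [map_mul, map_const, map_univ] at this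
  exact this.symm

theorem leftTranslate_leftTranslate (g h : Points K R K) (f : R) :
    leftTranslate g (leftTranslate h f) = leftTranslate (h * g) f := by
  rw [leftTranslate_apply g, eval_leftTranslate, leftTranslate_apply, map_mul, mul_assoc]

theorem leftTranslate_one (f : R) : leftTranslate (1 : Points K R K) f = f := by
  rw [leftTranslate_apply, map_one, one_mul, eval_univ]

/-- The evaluation of functions with coefficients in `B` at a `B`-point. -/
def pairing (x : Points K R B) : B ⊗[K] R →ₐ[K] B :=
  Algebra.TensorProduct.lift (AlgHom.id K B) (WithConv.ofConv x) fun _ _ => Commute.all _ _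

theorem pairing_tmul (x : Points K R B) (b : B) (f : R) : pairing x (b ⊗ₜ f) = b * x.eval f := rfl

/-- A point `g` of `G(B)`, viewed as a point with values in `B`-valued functions on `G`. -/
def left (g : Points K R B) : Points K R (B ⊗[K] R) := map Algebra.TensorProduct.includeLeft g

variable (K R B) in
/-- The universal point, viewed as a point with values in `B`-valued functions on `G`. -/
def right : Points K R (B ⊗[K] R) := map Algebra.TensorProduct.includeRight univ

@[simp]
theorem map_pairing_left (x g : Points K R B) : map (pairing x) (left g) = g :=
  ext fun f => by
    rw [left, map_map, eval_map, AlgHom.comp_apply, Algebra.TensorProduct.includeLeft_apply,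
      pairing_tmul]
    simp [eval, map_one]

@[simp]
theorem map_pairing_right (x : Points K R B) : map (pairing x) (right K R B) = x :=
  ext fun f => by
    rw [right, map_map, eval_map, AlgHom.comp_apply, Algebra.TensorProduct.includeRight_apply,
      pairing_tmul, one_mul]
    rfl

/-- The `B`-point `x` lies in the Zariski closure of the set `S` of rational points. -/
def InClosure (S : Set (Points K R K)) (x : Points K R B) : Prop :=
  ∀ f : R, (∀ h ∈ S, h.eval f = 0) → x.eval f = 0

/-- A function with coefficients in `B` that vanishes on `S` vanishes on the closure of `S`. -/
theorem InClosure.pairing_eq_zero {S : Set (Points K R K)} {x : Points K R B} (hx : InClosure S x)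
    {w : B ⊗[K] R} (hw : ∀ h ∈ S, pairing (const B h) w = 0) : pairing x w = 0 := by
  classical
  -- Over a basis of `B`, vanishing at rational points splits into vanishing of each coefficient
  -- function in `R`.
  let b := Module.Basis.ofVectorSpace K B
  obtain ⟨c, rfl⟩ := TensorProduct.eq_repr_basis_left b w
  have hc : ∀ i, x.eval (c i) = 0 := by
    refine fun i => hx _ fun h hh => ?_
    have h1 := hw h hh
    rw [Finsupp.sum, map_sum] at h1
    have h2 : ∑ i ∈ c.support, h.eval (c i) • b i = 0 := by
      rw [← h1]
      refine Finset.sum_congr rfl fun i _ => ?_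
      rw [pairing_tmul, eval_const, Algebra.smul_def, mul_comm]
    by_cases hi : i ∈ c.support
    · exact linearIndependent_iff'.mp b.linearIndependent _ _ h2 i hi
    · rw [Finsupp.notMem_support_iff.mp hi]
      exact _root_.map_zero (WithConv.ofConv h)
  rw [Finsupp.sum, map_sum]
  refine Finset.sum_eq_zero fun i _ => ?_
  rw [pairing_tmul, hc, mul_zero]

/-- Points `u`, `v` over `B ⊗ R` are families of `B`-points parametrized by `G`; an identity between
them extends from `S` to its closure. -/
theorem InClosure.eval_map_pairing_eq {S : Set (Points K R K)} {x : Points K R B}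
    (hx : InClosure S x) {u v : Points K R (B ⊗[K] R)} {f : R}
    (h : ∀ h ∈ S, (map (pairing (const B h)) u).eval f = (map (pairing (const B h)) v).eval f) :
    (map (pairing x) u).eval f = (map (pairing x) v).eval f := by
  rw [eval_map, eval_map, ← sub_eq_zero, ← map_sub]
  refine hx.pairing_eq_zero fun g hg => ?_
  rw [map_sub, sub_eq_zero]
  exact h g hg

theorem InClosure.commute {S : Set (Points K R K)} {x g : Points K R B} (hx : InClosure S x)
    (hg : ∀ h ∈ S, Commute (const B h) g) : Commute x g := by
  refine ext fun f => ?_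
  have := hx.eval_map_pairing_eq (u := right K R B * left g) (v := left g * right K R B) (f := f)
  simp only [map_mul, map_pairing_left, map_pairing_right] at this
  exact this fun h hh => by rw [(hg h hh).eq]

theorem InClosure.eval_mul_eq {S : Set (Points K R K)} {x z : Points K R B} (hx : InClosure S x)
    {f : R} (hz : ∀ h ∈ S, (const B h * z).eval f = (const B h).eval f) :
    (x * z).eval f = x.eval f := by
  have := hx.eval_map_pairing_eq (u := right K R B * left z) (v := right K R B) (f := f)
  simp only [map_mul, map_pairing_left, map_pairing_right] at this
  exact this hz

/-- The variables are moved into the closure one at a time: first `x` with `y` fixed, then `y` with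
`x = h` rational. -/
theorem InClosure.mul {H : Subgroup (Points K R K)} {x y : Points K R B}
    (hx : InClosure (H : Set (Points K R K)) x) (hy : InClosure (H : Set (Points K R K)) y) :
    InClosure (H : Set (Points K R K)) (x * y) := by
  intro f hf
  have key := hx.pairing_eq_zero (w := (right K R B * left y).eval f)
  simp only [← eval_map, map_mul, map_pairing_left, map_pairing_right] at key
  refine key fun h hh => ?_
  rw [← eval_leftTranslate]
  refine hy _ fun k hk => ?_
  rw [eval_leftTranslate, const_self]
  exact hf _ (H.mul_mem hh hk)

variable (B) in
/-- The points of the Zariski closure of a group of rational points form a group. -/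
def closure (H : Subgroup (Points K R K)) : Subgroup (Points K R B) where
  carrier := {x | InClosure (H : Set (Points K R K)) x}
  mul_mem' := InClosure.mul
  one_mem' f hf := by
    have := hf 1 H.one_mem
    rw [← map_one (const B), eval_const, this, map_zero]
  inv_mem' {x} hx f hf := by
    rw [eval_inv]
    exact hx _ fun h hh => by rw [← eval_inv]; exact hf _ (H.inv_mem hh)

theorem mem_closure {H : Subgroup (Points K R K)} {x : Points K R B} :
    x ∈ closure B H ↔ ∀ f : R, (∀ h ∈ H, h.eval f = 0) → x.eval f = 0 := Iff.rfl

theorem _root_.AffineGroup.IsZariskiDense.inClosure {H : Subgroup (Points K R K)}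
    (hH : IsZariskiDense H) (x : Points K R B) : InClosure (H : Set (Points K R K)) x := by
  intro f hf
  rw [hH f hf]
  exact _root_.map_zero (WithConv.ofConv x)

/-- The ideal of functions vanishing on a group of rational points. -/
def vanishingIdeal (H : Subgroup (Points K R K)) : Ideal R where
  carrier := {f | ∀ h ∈ H, h.eval f = 0}
  zero_mem' h _ := _root_.map_zero (WithConv.ofConv h)
  add_mem' {a b} ha hb h hh := by
    have := _root_.map_add (WithConv.ofConv h) a b
    exact this.trans ((congrArg₂ (· + ·) (ha h hh) (hb h hh)).trans (add_zero 0))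
  smul_mem' c a ha h hh := by
    have := _root_.map_mul (WithConv.ofConv h) c a
    exact this.trans ((congrArg (h.eval c * ·) (ha h hh)).trans (mul_zero _))

/-- A subgroup of finite index of a Zariski dense group of rational points of a connected group
is Zariski dense. -/
theorem _root_.AffineGroup.IsZariskiDense.of_finiteIndex [ConnectedSpace (PrimeSpectrum R)]
    {H H' : Subgroup (Points K R K)} (hH : IsZariskiDense H) (hfin : (H'.subgroupOf H).FiniteIndex) :
    IsZariskiDense H' := by
  let I := vanishingIdeal H'
  let M : Subgroup H := (closure K H').subgroupOf H
  have hle : H' ≤ closure K H' := fun h hh f hf => hf h hh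
  have : M.FiniteIndex := Subgroup.finiteIndex_of_le (Subgroup.subgroupOf_mono H hle)
  -- `J c` is the ideal of functions vanishing on `h H'`, with `h` a representative of `c`. These
  -- finitely many closed translates cover `G` by density of `H`.
  let J : H ⧸ M → Ideal R := fun c => I.comap (leftTranslate (c.out : Points K R K))
  have hJ : ⨅ c, J c = ⊥ := by
    refine eq_bot_iff.mpr fun f hf => hH f fun h hh => ?_
    let c : H ⧸ M := QuotientGroup.mk (⟨h, hh⟩ : H)
    have h1 : leftTranslate (c.out : Points K R K) f ∈ I := (Ideal.mem_iInf.mp hf) c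
    have h2 : (c.out)⁻¹ * (⟨h, hh⟩ : H) ∈ M := QuotientGroup.eq.mp (QuotientGroup.out_eq' c)
    have h3 := mem_closure.mp (Subgroup.mem_subgroupOf.mp h2) _ h1
    rw [eval_leftTranslate, const_self] at h3
    simpa using h3
  -- The translates with `c ≠ 1` miss the closure of `H'`: at a common prime `p`, the tautological
  -- point over `R ⧸ p` puts `h` in the closure, and `K` injects into `R ⧸ p`.
  have hone : ∀ c, ∀ p : PrimeSpectrum R, I ≤ p.asIdeal → J c ≤ p.asIdeal →
      c = QuotientGroup.mk (1 : H) := by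
    intro c p h1 h2
    let x : Points K R (R ⧸ p.asIdeal) := WithConv.toConv (Ideal.Quotient.mkₐ K p.asIdeal)
    set h : Points K R K := (c.out : Points K R K) with hh
    have hx : x ∈ closure _ H' := fun f hf => Ideal.Quotient.eq_zero_iff_mem.mpr (h1 hf)
    have hx' : const _ h⁻¹ * x ∈ closure _ H' := by
      intro f hf
      rw [← eval_leftTranslate]
      refine Ideal.Quotient.eq_zero_iff_mem.mpr (h2 ?_)
      change leftTranslate h (leftTranslate h⁻¹ f) ∈ I
      rw [leftTranslate_leftTranslate, inv_mul_cancel, leftTranslate_one]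
      exact hf
    have hch : const _ h ∈ closure (R ⧸ p.asIdeal) H' := by
      have := Subgroup.mul_mem _ hx (Subgroup.inv_mem _ hx')
      simpa using this
    have hM : c.out ∈ M := by
      refine Subgroup.mem_subgroupOf.mpr fun f hf => ?_
      have := hch f hf
      rw [eval_const] at this
      exact (map_eq_zero_iff _ (algebraMap K (R ⧸ p.asIdeal)).injective).mp this
    rw [← QuotientGroup.out_eq' c]
    exact QuotientGroup.eq.mpr (by simpa using hM)
  have hcl : IsClopen (PrimeSpectrum.zeroLocus (I : Set R)) := by
    refine ⟨PrimeSpectrum.isClosed_zeroLocus _, ?_⟩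
    have : (PrimeSpectrum.zeroLocus (I : Set R))ᶜ =
        ⋃ c : {c : H ⧸ M // c ≠ QuotientGroup.mk (1 : H)}, PrimeSpectrum.zeroLocus (J c : Set R) := by
      ext p
      simp only [Set.mem_compl_iff, PrimeSpectrum.mem_zeroLocus, SetLike.coe_subset_coe,
        Set.mem_iUnion]
      constructor
      · intro hp
        obtain ⟨c, hc⟩ : ∃ c, J c ≤ p.asIdeal := by
          have : ⨅ c, J c ≤ p.asIdeal := hJ ▸ bot_le
          have hF := Fintype.ofFinite (H ⧸ M)
          rw [← Finset.inf_univ_eq_iInf] at this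
          obtain ⟨c, -, hc⟩ := (Ideal.IsPrime.inf_le' p.2).mp this
          exact ⟨c, hc⟩
        refine ⟨⟨c, ?_⟩, hc⟩
        intro hc1
        apply hp
        intro f hf
        refine hc ?_
        intro h hh
        rw [eval_leftTranslate, const_self]
        have h1 : c.out ∈ M := by
          have := QuotientGroup.eq.mp ((QuotientGroup.out_eq' c).trans hc1)
          simpa using this
        exact (closure K H').mul_mem h1 (hle hh) f hf
      · rintro ⟨⟨c, hc⟩, hp⟩ hI
        exact hc (hone c p hI hp)
    rw [← isClosed_compl_iff, this]
    exact isClosed_iUnion_of_finite fun _ => PrimeSpectrum.isClosed_zeroLocus _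
  have huniv := hcl.eq_univ ⟨⟨Bialgebra.augmentationIdeal K R, inferInstance⟩, fun f hf => by
    have := hf 1 H'.one_mem
    exact this⟩
  intro f hf
  -- Connectedness only makes `f` nilpotent; density of `H` then gives `f = 0`, as nilpotents vanish
  -- at rational points.
  have hnil : IsNilpotent f := (PrimeSpectrum.zeroLocus_eq_univ_iff _).mp huniv hf
  exact hH f fun h _ => (hnil.map (WithConv.ofConv h)).eq_zero

end Points

end

end AffineGroup

/-! ### Nullstellensatz, descent to the base field, Cartier's theorem -/

theorem Ideal.exists_algHom_ker_eq {K Q : Type*} (L : Type*) [Field K] [Field L] [IsAlgClosed L]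
    [Algebra K L] [CommRing Q] [Algebra K Q] [Algebra.FiniteType K Q] (M : Ideal Q)
    [M.IsMaximal] : ∃ φ : Q →ₐ[K] L, RingHom.ker φ = M := by
  let _ := Ideal.Quotient.field M
  have : Module.Finite K (Q ⧸ M) := finite_of_finite_type_of_isJacobsonRing K (Q ⧸ M)
  refine ⟨(IsAlgClosed.lift : (Q ⧸ M) →ₐ[K] L).comp (Ideal.Quotient.mkₐ K M), ?_⟩
  ext f
  rw [RingHom.mem_ker, AlgHom.comp_apply, ← Ideal.Quotient.eq_zero_iff_mem]
  exact map_eq_zero_iff (IsAlgClosed.lift : (Q ⧸ M) →ₐ[K] L).toRingHom (RingHom.injective _)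

/-- Apply `l ⊗ id` for a `K`-linear retraction `l` of `K → A`. -/
theorem Algebra.exists_algebraMap_eq_of_tmul_one_eq {K A : Type*} [Field K] [CommRing A]
    [Algebra K A] {a : A} (h : a ⊗ₜ[K] (1 : A) = 1 ⊗ₜ a) : ∃ c, algebraMap K A c = a := by
  rcases subsingleton_or_nontrivial A with _ | _
  · exact ⟨0, Subsingleton.elim _ _⟩
  obtain ⟨l, hl⟩ := (Algebra.linearMap K A).exists_leftInverse_of_injective
    (LinearMap.ker_eq_bot.mpr (algebraMap K A).injective)
  have hl1 : l 1 = 1 := by simpa using LinearMap.congr_fun hl 1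
  refine ⟨l a, ?_⟩
  simpa [hl1, Algebra.smul_def] using congrArg (TensorProduct.lid K A ∘ l.rTensor A) h

namespace HopfAlgebra

open AffineGroup

/-- The annihilator of a nonzero nilpotent would vanish at some rational point `x`. Translating `x`
to the identity, killing the nilpotent there by a function with value 1, and translating back gives
an annihilating function that is nonzero at `x`. -/
theorem isReduced_of_isAlgClosed (K Q : Type*) [Field K] [CharZero K] [IsAlgClosed K] [CommRing Q]
    [HopfAlgebra K Q] [Algebra.FiniteType K Q] : IsReduced Q := by
  have : IsNoetherianRing Q := Algebra.FiniteType.isNoetherianRing K Q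
  refine ⟨fun f hf => ?_⟩
  by_contra hf0
  have hT : Ideal.torsionOf Q Q f ≠ ⊤ := fun h => hf0 ((Ideal.torsionOf_eq_top_iff Q f).mp h)
  obtain ⟨M, hM, hTM⟩ := Ideal.exists_le_maximal _ hT
  obtain ⟨φ, hφ⟩ := M.exists_algHom_ker_eq (K := K) K
  let x : Points K Q K := WithConv.toConv φ
  obtain ⟨u, hu, huf⟩ := Bialgebra.exists_mul_eq_zero_of_isNilpotent (K := K)
    (hf.map (Points.leftTranslate x))
  have h1 := congrArg (Points.leftTranslate x⁻¹) huf
  rw [map_mul, Points.leftTranslate_leftTranslate, mul_inv_cancel, Points.leftTranslate_one,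
    map_zero] at h1
  have h2 : Points.leftTranslate x⁻¹ u ∈ RingHom.ker φ :=
    hφ ▸ hTM ((Ideal.mem_torsionOf_iff _ _).mpr h1)
  have h3 : x.eval (Points.leftTranslate x⁻¹ u) = 0 := h2
  rw [Points.eval_leftTranslate, Points.const_self, inv_mul_cancel, Points.eval_one, hu,
    map_one] at h3
  exact one_ne_zero h3

/-- **Cartier's theorem**: affine algebraic groups over a field of characteristic zero are
reduced. -/
theorem isReduced (K Q : Type*) [Field K] [CharZero K] [CommRing Q] [HopfAlgebra K Q]
    [Algebra.FiniteType K Q] : IsReduced Q := by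
  have : CharZero (AlgebraicClosure K) := charZero_of_injective_algebraMap
    (algebraMap K (AlgebraicClosure K)).injective
  have := isReduced_of_isAlgClosed (AlgebraicClosure K) (TensorProduct K (AlgebraicClosure K) Q)
  exact isReduced_of_injective
    (Algebra.TensorProduct.includeRight : Q →ₐ[K] TensorProduct K (AlgebraicClosure K) Q)
    (Algebra.TensorProduct.includeRight_injective (algebraMap K (AlgebraicClosure K)).injective)

end HopfAlgebra

/-! ### Centralizers of dense subgroups and the commensurator -/

namespace AffineGroup

open TensorProduct

noncomputable section

namespace Points

variable {K R : Type*} [Field K] [CommRing R] [HopfAlgebra K R]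
  {A B : Type*} [CommRing A] [Algebra K A] [CommRing B] [Algebra K B]

/-- The ideal of the scheme-theoretic centralizer of a group of rational points. -/
def centralizerIdeal (H : Subgroup (Points K R K)) : Ideal R :=
  Ideal.span {r | ∃ h ∈ H, ∃ f, r = (const R h * univ).eval f - (univ * const R h).eval f}

theorem forall_mem_centralizerIdeal_iff {H : Subgroup (Points K R K)} {x : Points K R B} :
    (∀ f ∈ centralizerIdeal H, x.eval f = 0) ↔ ∀ h ∈ H, Commute (const B h) x := by
  have key : ∀ h f, x.eval ((const R h * univ).eval f - (univ * const R h).eval f) =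
      (const B h * x).eval f - (x * const B h).eval f := by
    intro h f
    have h1 := eval_map (WithConv.ofConv x) (const R h * univ) f
    have h2 := eval_map (WithConv.ofConv x) (univ * const R h) f
    rw [map_mul, map_const, map_univ] at h1 h2
    rw [h1, h2]
    exact map_sub (WithConv.ofConv x) _ _
  constructor
  · intro hx h hh
    refine ext fun f => ?_
    rw [← sub_eq_zero, ← key]
    exact hx _ (Ideal.subset_span ⟨h, hh, f, rfl⟩)
  · intro hx
    have : centralizerIdeal H ≤ RingHom.ker (WithConv.ofConv x) := by
      refine Ideal.span_le.mpr ?_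
      rintro _ ⟨h, hh, f, rfl⟩
      refine (key h f).trans ?_
      rw [(hx h hh).eq, sub_self]
    exact fun f hf => this hf

/-- Makes the quotient ring a Hopf algebra, so that Cartier's theorem applies to it. The axioms say
that `1`, products and inverses of centralizing points centralize, tested on the universal point
`q`. -/
instance (H : Subgroup (Points K R K)) : (centralizerIdeal H).IsHopfIdeal K := by
  let Q := R ⧸ centralizerIdeal H
  let q : Points K R Q := WithConv.toConv (Ideal.Quotient.mkₐ K (centralizerIdeal H))
  have hq : ∀ h ∈ H, Commute (const Q h) q := forall_mem_centralizerIdeal_iff.mp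
    fun f hf => Ideal.Quotient.eq_zero_iff_mem.mpr hf
  refine { counit_eq_zero := ?_, map_mkQ_comul_eq_zero := ?_, antipode_mem := ?_ }
  · intro f hf
    exact forall_mem_centralizerIdeal_iff.mpr (fun h _ => Commute.one_right (const K h)) f hf
  · intro f hf
    let q₁ : Points K R (Q ⊗[K] Q) := map Algebra.TensorProduct.includeLeft q
    let q₂ : Points K R (Q ⊗[K] Q) := map Algebra.TensorProduct.includeRight q
    have h₁ : ∀ h ∈ H, Commute (const _ h) (q₁ * q₂) := by
      intro h hh
      have e₁ := (hq h hh).map (map (R := R) (Algebra.TensorProduct.includeLeft : Q →ₐ[K] Q ⊗[K] Q))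
      have e₂ := (hq h hh).map (map (R := R) (Algebra.TensorProduct.includeRight : Q →ₐ[K] Q ⊗[K] Q))
      rw [map_const] at e₁ e₂
      exact e₁.mul_right e₂
    have h₂ := forall_mem_centralizerIdeal_iff.mpr h₁ f hf
    have : Algebra.TensorProduct.lift (WithConv.ofConv q₁) (WithConv.ofConv q₂)
        (fun _ _ => .all ..) = Algebra.TensorProduct.map (WithConv.ofConv q) (WithConv.ofConv q) := by
      ext a
      · simp; rfl
      · simp; rfl
    have h₃ : Algebra.TensorProduct.map (WithConv.ofConv q) (WithConv.ofConv q)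
        (Coalgebra.comul f) = 0 := by
      rw [← this]
      exact (AlgHom.convMul_apply _ _ _).symm.trans h₂
    exact h₃
  · intro f hf
    have := forall_mem_centralizerIdeal_iff.mpr (fun h hh => (hq h hh).inv_right) f hf
    exact Ideal.Quotient.eq_zero_iff_mem.mp this

variable [CharZero K] [Algebra.FiniteType K R]

/-- In characteristic zero, the centralizer of a group of rational points is determined by its
geometric points. -/
theorem mem_centralizerIdeal_of_forall {H : Subgroup (Points K R K)} {f : R}
    (hf : ∀ z : Points K R (AlgebraicClosure K), (∀ h ∈ H, Commute (const _ h) z) → z.eval f = 0) :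
    f ∈ centralizerIdeal H := by
  have hred : (centralizerIdeal H).IsRadical := by
    rw [Ideal.isRadical_iff_quotient_reduced]
    exact HopfAlgebra.isReduced K _
  have : IsJacobsonRing R := isJacobsonRing_of_finiteType (A := K)
  rw [← IsJacobsonRing.out this hred, Ideal.jacobson, Ideal.mem_sInf]
  rintro M ⟨hJM, hM⟩
  obtain ⟨φ, hφ⟩ := M.exists_algHom_ker_eq (K := K) (AlgebraicClosure K)
  rw [← hφ] at hJM ⊢
  exact hf (WithConv.toConv φ) (forall_mem_centralizerIdeal_iff.mp fun r hr => hJM hr)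

/-- Functions on the quotient by the center are invariant under all points, with values in any
algebra, which centralize a dense group of rational points. -/
theorem eval_mul_of_mem_centerQuotientRing {H : Subgroup (Points K R K)} (hH : IsZariskiDense H)
    {f : R} (hf : f ∈ centerQuotientRing K R) (x : Points K R B) {z : Points K R B}
    (hz : ∀ h ∈ H, Commute (const B h) z) : (x * z).eval f = x.eval f := by
  refine (hH.inClosure x).eval_mul_eq fun h hh => ?_
  -- By density, geometric points centralizing `H` are central, so `f(h ·) - f(h)` vanishes at them;
  -- hence it vanishes at every point of the centralizer, including `z`.
  have hmem : leftTranslate h f - algebraMap K R (h.eval f) ∈ centralizerIdeal H := by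
    refine mem_centralizerIdeal_of_forall fun y hy => ?_
    have hyc : y ∈ Subgroup.center _ :=
      Subgroup.mem_center_iff.mpr fun x => ((hH.inClosure x).commute hy).eq
    have h1 := hf (const _ h) y hyc
    rw [← eval_leftTranslate, eval_const, ← sub_eq_zero] at h1
    rw [← h1]
    refine (map_sub (WithConv.ofConv y) _ _).trans ?_
    rw [AlgHom.commutes]
    rfl
  have h2 := forall_mem_centralizerIdeal_iff.mpr hz _ hmem
  have h3 := (map_sub (WithConv.ofConv z) (leftTranslate h f)
    (algebraMap K R (h.eval f))).symm.trans h2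
  rw [AlgHom.commutes, sub_eq_zero] at h3
  rw [← eval_leftTranslate]
  exact h3

omit [CharZero K] [Algebra.FiniteType K R] in
theorem finiteIndex_of_mem_commensurator {H : Subgroup (Points K R K)} {g : Points K R A}
    (hg : g ∈ Subgroup.Commensurable.commensurator (H.map (const A))) :
    ((((H.map (const A)).comap (MulAut.conj g).toMonoidHom).comap (const A)).subgroupOf
      H).FiniteIndex := by
  have h := ((Subgroup.Commensurable.commensurator_mem_iff _ _).mp hg).2
  constructor
  change Subgroup.relIndex _ _ ≠ 0
  rw [Subgroup.relIndex_comap, Subgroup.relIndex_comap]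
  exact h

theorem exists_algebraMap_eq_eval [ConnectedSpace (PrimeSpectrum R)]
    {H : Subgroup (Points K R K)} (hH : IsZariskiDense H) {g : Points K R A}
    (hg : g ∈ Subgroup.Commensurable.commensurator (H.map (const A)))
    {f : R} (hf : f ∈ centerQuotientRing K R) : ∃ c, algebraMap K A c = g.eval f := by
  have hdense := hH.of_finiteIndex (finiteIndex_of_mem_commensurator hg)
  let i₁ : A →ₐ[K] A ⊗[K] A := Algebra.TensorProduct.includeLeft
  let i₂ : A →ₐ[K] A ⊗[K] A := Algebra.TensorProduct.includeRight
  have key := eval_mul_of_mem_centerQuotientRing hdense hf (map i₁ g)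
    (z := (map i₁ g)⁻¹ * map i₂ g) fun h hh => by
      -- Only the rationality of `k = g h g⁻¹` matters: both maps `A → A ⊗ A` send it to the same
      -- point.
      obtain ⟨k, -, hk⟩ := hh
      have hk' : const A k = g * const A h * g⁻¹ := hk
      have e₁ := congrArg (map i₁) hk'
      have e₂ := congrArg (map i₂) hk'
      simp only [map_mul, map_inv, map_const] at e₁ e₂
      have e := e₁.symm.trans e₂
      rw [mul_inv_eq_iff_eq_mul] at e
      rw [commute_iff_eq, ← mul_right_inj (map i₁ g), ← mul_left_inj (map i₂ g)⁻¹]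
      rw [← mul_assoc, e]
      group
  rw [mul_inv_cancel_left] at key
  exact Algebra.exists_algebraMap_eq_of_tmul_one_eq key.symm

end Points

end

end AffineGroup

theorem theoremA1 {K R A : Type*} [Field K] [CharZero K]
    [CommRing R] [HopfAlgebra K R] [Algebra.FiniteType K R]
    [ConnectedSpace (PrimeSpectrum R)]
    [CommRing A] [Algebra K A]
    (H : Subgroup (AffineGroup.Points K R K)) (hH : AffineGroup.IsZariskiDense H) :
    AffineGroup.Points.toCenterQuotient ''
        (Subgroup.Commensurable.commensurator
          (H.map (AffineGroup.Points.map (Algebra.ofId K A))) :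
          Set (AffineGroup.Points K R A)) ⊆
      Set.range (AffineGroup.CenterQuotientPoints.map (K := K) (R := R) (Algebra.ofId K A)) := by
  rintro _ ⟨g, hg, rfl⟩
  -- For `A = 0` the map `K → A` is not injective, but any point of `(G/Z)(K)` will do.
  rcases subsingleton_or_nontrivial A with _ | _
  · exact ⟨(1 : AffineGroup.Points K R K).toCenterQuotient,
      AlgHom.ext fun _ => Subsingleton.elim _ _⟩
  have hinj : Function.Injective (algebraMap K A) := (algebraMap K A).injective
  have hbot : ∀ f, g.toCenterQuotient f ∈ (⊥ : Subalgebra K A) := fun f =>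
    Algebra.mem_bot.mpr (AffineGroup.Points.exists_algebraMap_eq_eval hH hg f.2)
  refine ⟨(Algebra.botEquivOfInjective hinj).toAlgHom.comp
    (g.toCenterQuotient.codRestrict ⊥ hbot), AlgHom.ext fun f => ?_⟩
  obtain ⟨c, hc⟩ := Algebra.mem_bot.mp (hbot f)
  have : g.toCenterQuotient.codRestrict ⊥ hbot f = algebraMap K _ c := Subtype.ext hc.symm
  simp only [AffineGroup.CenterQuotientPoints.map, AlgHom.comp_apply, this, AlgHom.commutes]
  exact hc
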